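/- Let $r>0$ and $f(x)=r(e^{x}-1)$, and consider the distributed delay differential equation $$x'(t)=-\int_0^1 f(x(t-s))\,ds,\qquad t\in\mathbb R. \tag{1}$$ Call a solution $x:\mathbb R\to\mathbb R$ of (1) a *special symmetric periodic solution* (SSPS) if its minimal period is $2$ and $x(t)+x(t-1)$ is constant in $t\in\mathbb R$. For $k\in(0,1)$ let $$K(k)=\int_0^{\pi/2}\frac{d\theta}{\sqrt{1-k^2\sin^2\theta}},\qquad E(k)=\int_0^{\pi/2}\sqrt{1-k^2\sin^2\theta}\,d\theta$$ be the complete elliptic integrals of the first and second kind, and let $\mathrm{cn}(\cdot,k)$, $\mathrm{dn}(\cdot,k)$ be the Jacobi elliptic functions with modulus $k$. Then (1) has an SSPS if and only if $r>\pi^2/2$. Moreover, if $r>\pi^2/2$, then the equation $$r=2K(k)\bigl(2E(k)-K(k)(1-k^2)\bigr)$$ has a unique solution $k\in(0,1)$, and, for this $k$, the function $$x(t)=\log\left(\frac{K(k)\bigl(\mathrm{dn}(2K(k)t,k)+k\,\mathrm{cn}(2K(k)t,k)\bigr)^2}{2E(k)-K(k)(1-k^2)}\right)$$ is an SSPS of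 (1), and every SSPS of (1) is a time translate $t\mapsto x(t+t_0)$, $t_0\in\mathbb R$, of it. -/

import Mathlib

noncomputable section

/-- `x : ℝ → ℝ` solves the distributed delay equation `x'(t) = -∫₀¹ f(x(t - s)) ds` on all of `ℝ`. -/
def IsDelaySolution (f x : ℝ → ℝ) : Prop :=
  ∀ t : ℝ, HasDerivAt x (-∫ s in (0 : ℝ)..1, f (x (t - s))) t

/-- A special symmetric periodic solution of the distributed delay equation with nonlinearity `f`
(not assumed odd): a solution whose minimal period is `2` and for which `x(t) + x(t - 1)` is
constant. -/
structure IsSSPS (f x : ℝ → ℝ) : Prop where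
  solution : IsDelaySolution f x
  minimal_period : IsLeast {T : ℝ | 0 < T ∧ Function.Periodic x T} 2
  symmetric : ∃ c : ℝ, ∀ t : ℝ, x t + x (t - 1) = c

/-- Incomplete elliptic integral of the first kind, as a function of the modulus `k` and the
amplitude `φ`. -/
def ellipticF (k φ : ℝ) : ℝ :=
  ∫ θ in (0 : ℝ)..φ, 1 / √(1 - k ^ 2 * Real.sin θ ^ 2)

/-- Complete elliptic integral of the first kind with modulus `k`. -/
def ellipticK (k : ℝ) : ℝ := ellipticF k (Real.pi / 2)

/-- Complete elliptic integral of the second kind with modulus `k`. -/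
def ellipticE (k : ℝ) : ℝ :=
  ∫ θ in (0 : ℝ)..(Real.pi / 2), √(1 - k ^ 2 * Real.sin θ ^ 2)

/-- For a modulus `k ∈ (0, 1)` the map `φ ↦ F(φ, k)` is a bijection of `ℝ`, so that its inverse,
the Jacobi amplitude, is a genuine inverse. -/
theorem ellipticF_bijective {k : ℝ} (hk : k ∈ Set.Ioo (0 : ℝ) 1) :
    Function.Bijective (ellipticF k) := by
  have hpos : ∀ θ : ℝ, 0 < 1 - k ^ 2 * Real.sin θ ^ 2 := fun θ => by
    have h1 := Real.sin_sq_le_one θ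
    have h2 : k ^ 2 < 1 := by nlinarith [hk.1, hk.2]
    nlinarith [sq_nonneg k, sq_nonneg (Real.sin θ)]
  have hge : ∀ θ : ℝ, 1 ≤ 1 / √(1 - k ^ 2 * Real.sin θ ^ 2) := fun θ => by
    rw [le_div_iff₀ (Real.sqrt_pos.2 (hpos θ)), one_mul]
    exact Real.sqrt_le_one.2 (by nlinarith [mul_nonneg (sq_nonneg k) (sq_nonneg (Real.sin θ))])
  have hcont : Continuous fun θ : ℝ => 1 / √(1 - k ^ 2 * Real.sin θ ^ 2) :=
    continuous_const.div (by fun_prop) fun θ => (Real.sqrt_pos.2 (hpos θ)).ne'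
  have hder : ∀ φ, HasDerivAt (ellipticF k) (1 / √(1 - k ^ 2 * Real.sin φ ^ 2)) φ := fun φ =>
    (hcont.integral_hasStrictDerivAt 0 φ).hasDerivAt
  have hmono : Monotone fun φ => ellipticF k φ - φ :=
    monotone_of_hasDerivAt_nonneg (fun φ => (hder φ).sub (hasDerivAt_id φ)) fun φ => by
      simpa using hge φ
  have h0 : ellipticF k 0 = 0 := by simp [ellipticF]
  constructor
  · refine StrictMono.injective fun a b hab => ?_
    have := hmono hab.le
    simp only at this
    linarith
  · refine Continuous.surjective (continuous_iff_continuousAt.2 fun φ => (hder φ).continuousAt) ?_ ?_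
    · refine Filter.tendsto_atTop_mono' _ ?_ Filter.tendsto_id
      filter_upwards [Filter.eventually_ge_atTop 0] with φ hφ
      have := hmono hφ
      simp only [h0, id] at this ⊢
      linarith
    · refine Filter.tendsto_atBot_mono' _ ?_ Filter.tendsto_id
      filter_upwards [Filter.eventually_le_atBot 0] with φ hφ
      have := hmono hφ
      simp only [h0, id] at this ⊢
      linarith

/-- Jacobi amplitude `am(u, k)`: the inverse of `φ ↦ F(φ, k)`. -/
def jacobiAm (u k : ℝ) : ℝ := Function.invFun (ellipticF k) u

/-- Jacobi elliptic function `sn(u, k)`. -/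
def jacobiSn (u k : ℝ) : ℝ := Real.sin (jacobiAm u k)

/-- Jacobi elliptic function `cn(u, k)`. -/
def jacobiCn (u k : ℝ) : ℝ := Real.cos (jacobiAm u k)

/-- Jacobi elliptic function `dn(u, k)`. -/
def jacobiDn (u k : ℝ) : ℝ := √(1 - k ^ 2 * jacobiSn u k ^ 2)

/-- The explicit profile with modulus `k`. -/
def logisticProfile (k t : ℝ) : ℝ :=
  Real.log (ellipticK k *
      (jacobiDn (2 * ellipticK k * t) k + k * jacobiCn (2 * ellipticK k * t) k) ^ 2 /
    (2 * ellipticE k - ellipticK k * (1 - k ^ 2)))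

end

/-!
Let `2 m` be the constant value of `x(t) + x(t - 1)`. Differentiating the equation and using the
symmetry to eliminate the delayed term turns it into the pendulum-like equation
`y'' = -2 r eᵐ sinh y` for `y = x - m`. The function `p = log ((dn + k cn) / (dn - k cn))` solves
`p'' = -(1 - k²) sinh p`, so by uniqueness at a maximum `t₁` of `x` one gets
`x(t) = m + p(ω (t - t₁))` with `k = tanh ((x(t₁) - m) / 2)`, and minimal period `2` forces
`ω = 2 K(k)`. Since `(dn + k cn)² = 2 dn² - (1 - k²) + 2 k sn'` integrates over a half-period to
`2 P(k) + 4 k sn`, where `P(k) = 2 E(k) - (1 - k²) K(k)`, a function `m + p(2 K t + b)` solves the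
delay equation exactly when `eᵐ = (1 - k²) K / P` and `r = 2 K P`. Finally `k ↦ 2 K P` is a
bijection from `(0, 1)` onto `(π² / 2, ∞)`, because `K` increases to infinity and
`P(l) - P(k) = (l² - k²) ∫ cos² / (Δ(k) + Δ(l))` with `Δ(k) = √(1 - k² sin²)`.
-/

noncomputable section

open Real Set Filter Topology

section Periodic

theorem intervalIntegral_add_eq_two_mul_of_periodic_of_even {g : ℝ → ℝ} {T : ℝ}
    (hg : Continuous g) (hper : Function.Periodic g T) (heven : Function.Even g) (a : ℝ) :
    ∫ s in a..(a + T), g s = 2 * ∫ s in (0 : ℝ)..(T / 2), g s := by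
  have hneg : ∫ s in (-(T / 2))..0, g s = ∫ s in (0 : ℝ)..(T / 2), g s := by
    simpa only [heven _, neg_neg, neg_zero] using
      intervalIntegral.integral_comp_neg (a := -(T / 2)) (b := 0) g
  calc ∫ s in a..(a + T), g s = ∫ s in (-(T / 2))..(-(T / 2) + T), g s :=
        hper.intervalIntegral_add_eq a _
    _ = (∫ s in (-(T / 2))..0, g s) + ∫ s in (0 : ℝ)..(T / 2), g s := by
        rw [intervalIntegral.integral_add_adjacent_intervals (hg.intervalIntegrable _ _)
          (hg.intervalIntegrable _ _), show -(T / 2) + T = T / 2 by ring]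
    _ = 2 * ∫ s in (0 : ℝ)..(T / 2), g s := by rw [hneg, two_mul]

theorem periodic_const_add_comp_affine_iff {f : ℝ → ℝ} {ω : ℝ} (hω : ω ≠ 0) (a b T : ℝ) :
    Function.Periodic (fun t => a + f (ω * t + b)) T ↔ Function.Periodic f (ω * T) := by
  refine ⟨fun h u => ?_, fun h t => ?_⟩
  · have := h ((u - b) / ω)
    simp only [add_right_inj] at this
    rwa [mul_add, mul_div_cancel₀ _ hω, add_right_comm, sub_add_cancel] at this
  · simp only [mul_add, add_right_comm _ (ω * T) b, h (ω * t + b)]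

theorem isLeast_period_const_add_comp_affine {f : ℝ → ℝ} {T ω : ℝ} (hω : 0 < ω) (a b : ℝ)
    (hT : IsLeast {T : ℝ | 0 < T ∧ Function.Periodic f T} T) :
    IsLeast {T : ℝ | 0 < T ∧ Function.Periodic (fun t => a + f (ω * t + b)) T} (T / ω) := by
  simp only [periodic_const_add_comp_affine_iff hω.ne']
  refine ⟨⟨div_pos hT.1.1 hω, ?_⟩, fun S hS => ?_⟩
  · rw [mul_div_cancel₀ _ hω.ne']
    exact hT.1.2
  · rw [div_le_iff₀' hω]
    exact hT.2 ⟨mul_pos hω hS.1, hS.2⟩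

end Periodic

section EllipticIntegrals

/-- The radical `Δ(θ, k) = √(1 - k² sin² θ)`, the common building block of the integrands of the
elliptic integrals of the first and second kind. -/
def ellipticDelta (k θ : ℝ) : ℝ := √(1 - k ^ 2 * sin θ ^ 2)

/-- The combination `P(k) = 2 E(k) - (1 - k²) K(k)` of complete elliptic integrals; `P / K` is the
mean value of `(dn + k cn)²`. -/
def ellipticP (k : ℝ) : ℝ := 2 * ellipticE k - ellipticK k * (1 - k ^ 2)

/-- The value `2 K(k) P(k)` of the coefficient `r` for which the profile with modulus `k` solves
the delay equation. -/
def profileParameter (k : ℝ) : ℝ := 2 * ellipticK k * ellipticP k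

variable {k l : ℝ}

theorem one_sub_sq_mul_sin_sq_pos (hk : k ^ 2 < 1) (θ : ℝ) : 0 < 1 - k ^ 2 * sin θ ^ 2 := by
  nlinarith [sin_sq_le_one θ, sq_nonneg k, sq_nonneg (sin θ)]

theorem ellipticDelta_pos (hk : k ^ 2 < 1) (θ : ℝ) : 0 < ellipticDelta k θ :=
  sqrt_pos.2 (one_sub_sq_mul_sin_sq_pos hk θ)

theorem ellipticDelta_sq (hk : k ^ 2 < 1) (θ : ℝ) :
    ellipticDelta k θ ^ 2 = 1 - k ^ 2 * sin θ ^ 2 :=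
  sq_sqrt (one_sub_sq_mul_sin_sq_pos hk θ).le

theorem periodic_ellipticDelta (k : ℝ) : Function.Periodic (ellipticDelta k) π := fun θ => by
  simp only [ellipticDelta, sin_add_pi, neg_sq]

theorem even_ellipticDelta (k : ℝ) : Function.Even (ellipticDelta k) := fun θ => by
  simp only [ellipticDelta, sin_neg, neg_sq]

theorem continuous_ellipticDelta (k : ℝ) : Continuous (ellipticDelta k) := by
  unfold ellipticDelta
  fun_prop

theorem continuous_one_div_ellipticDelta (hk : k ^ 2 < 1) :
    Continuous fun θ => 1 / ellipticDelta k θ :=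
  continuous_const.div (continuous_ellipticDelta k) fun θ => (ellipticDelta_pos hk θ).ne'

theorem hasDerivAt_ellipticDelta (hk : k ^ 2 < 1) (θ : ℝ) :
    HasDerivAt (ellipticDelta k) (-(k ^ 2 * sin θ * cos θ) / ellipticDelta k θ) θ := by
  have h : HasDerivAt (ellipticDelta k) _ θ :=
    ((((hasDerivAt_sin θ).pow 2).const_mul (k ^ 2)).const_sub 1).sqrt
      (one_sub_sq_mul_sin_sq_pos hk θ).ne'
  refine h.congr_deriv ?_
  have := (ellipticDelta_pos hk θ).ne'
  change _ / (2 * ellipticDelta k θ) = _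
  field_simp
  ring

theorem ellipticDelta_le_ellipticDelta (hkl : k ^ 2 ≤ l ^ 2) (θ : ℝ) :
    ellipticDelta l θ ≤ ellipticDelta k θ :=
  sqrt_le_sqrt (by gcongr)

theorem ellipticDelta_le_pi_div_two_add_sub (hk : k ^ 2 ≤ 1) {θ : ℝ} (hθ : θ ∈ Icc 0 (π / 2)) :
    ellipticDelta k θ ≤ π / 2 + √(1 - k ^ 2) - θ := by
  have hc : √(1 - k ^ 2) ^ 2 = 1 - k ^ 2 := sq_sqrt (by linarith)
  have hcos_nonneg : 0 ≤ cos θ :=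
    cos_nonneg_of_neg_pi_div_two_le_of_le (by linarith [hθ.1, pi_pos]) hθ.2
  have hcos_le : cos θ ≤ π / 2 - θ := by
    rw [← sin_pi_div_two_sub]
    exact sin_le (by linarith [hθ.2])
  have hsq : 1 - k ^ 2 * sin θ ^ 2 ≤ (cos θ + √(1 - k ^ 2)) ^ 2 := by
    nlinarith [sin_sq_add_cos_sq θ, sin_sq_le_one θ,
      mul_nonneg hcos_nonneg (sqrt_nonneg (1 - k ^ 2))]
  calc ellipticDelta k θ ≤ cos θ + √(1 - k ^ 2) :=
        sqrt_le_iff.2 ⟨add_nonneg hcos_nonneg (sqrt_nonneg _), hsq⟩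
    _ ≤ π / 2 + √(1 - k ^ 2) - θ := by linarith

theorem ellipticF_zero (k : ℝ) : ellipticF k 0 = 0 := intervalIntegral.integral_same

theorem hasDerivAt_ellipticF (hk : k ^ 2 < 1) (φ : ℝ) :
    HasDerivAt (ellipticF k) (1 / ellipticDelta k φ) φ :=
  ((continuous_one_div_ellipticDelta hk).integral_hasStrictDerivAt 0 φ).hasDerivAt

theorem strictMono_ellipticF (hk : k ^ 2 < 1) : StrictMono (ellipticF k) :=
  strictMono_of_hasDerivAt_pos (hasDerivAt_ellipticF hk)
    fun φ => one_div_pos.2 (ellipticDelta_pos hk φ)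

theorem surjective_ellipticF (hk : k ^ 2 < 1) : Function.Surjective (ellipticF k) := by
  rcases eq_or_ne k 0 with rfl | hk0
  · intro u
    exact ⟨u, by simp [ellipticF]⟩
  · have habs : ellipticF k = ellipticF |k| := by
      ext φ
      simp only [ellipticF, sq_abs]
    rw [habs]
    exact (ellipticF_bijective ⟨abs_pos.2 hk0, (sq_lt_one_iff_abs_lt_one k).1 hk⟩).2

theorem ellipticF_add_pi (hk : k ^ 2 < 1) (φ : ℝ) :
    ellipticF k (φ + π) = ellipticF k φ + 2 * ellipticK k := by
  have hc := continuous_one_div_ellipticDelta hk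
  have h : ∫ θ in φ..(φ + π), 1 / ellipticDelta k θ = 2 * ellipticK k :=
    intervalIntegral_add_eq_two_mul_of_periodic_of_even hc
      (fun θ => by simp only [periodic_ellipticDelta k θ])
      (fun θ => by simp only [even_ellipticDelta k θ]) φ
  rw [← h]
  exact (intervalIntegral.integral_add_adjacent_intervals (hc.intervalIntegrable _ _)
    (hc.intervalIntegrable _ _)).symm

theorem ellipticK_pos (hk : k ^ 2 < 1) : 0 < ellipticK k := by
  rw [← ellipticF_zero k]
  exact strictMono_ellipticF hk pi_div_two_pos

theorem ellipticK_zero : ellipticK 0 = π / 2 := by simp [ellipticK, ellipticF]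

theorem ellipticP_zero : ellipticP 0 = π / 2 := by
  simp [ellipticP, ellipticK_zero, ellipticE]
  ring

theorem ellipticK_lt_ellipticK (hkl : k ^ 2 < l ^ 2) (hl : l ^ 2 < 1) :
    ellipticK k < ellipticK l := by
  refine intervalIntegral.integral_lt_integral_of_continuousOn_of_le_of_exists_lt pi_div_two_pos
    (continuous_one_div_ellipticDelta (hkl.trans hl)).continuousOn
    (continuous_one_div_ellipticDelta hl).continuousOn
    (fun θ _ => one_div_le_one_div_of_le (ellipticDelta_pos hl θ)
      (ellipticDelta_le_ellipticDelta hkl.le θ))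
    ⟨π / 2, ⟨by positivity, le_rfl⟩, one_div_lt_one_div_of_lt (ellipticDelta_pos hl _) ?_⟩
  refine sqrt_lt_sqrt (one_sub_sq_mul_sin_sq_pos hl _).le ?_
  simpa only [sin_pi_div_two, one_pow, mul_one, sub_lt_sub_iff_left] using hkl

theorem neg_log_sqrt_one_sub_sq_le_ellipticK (hk : k ^ 2 < 1) :
    -log √(1 - k ^ 2) ≤ ellipticK k := by
  set c := √(1 - k ^ 2)
  have hc : 0 < c := sqrt_pos.2 (by linarith)
  have hpos : ∀ θ ∈ Icc 0 (π / 2), 0 < π / 2 + c - θ := fun θ hθ => by linarith [hθ.2]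
  have hint : IntervalIntegrable (fun θ => 1 / (π / 2 + c - θ)) MeasureTheory.volume 0 (π / 2) :=
    (continuousOn_const.div (by fun_prop) fun θ hθ => (hpos θ hθ).ne').intervalIntegrable_of_Icc
      pi_div_two_pos.le
  calc -log c = log (1 / c) := by rw [one_div, log_inv]
    _ ≤ log ((π / 2 + c) / c) := by
        gcongr
        linarith [pi_gt_three]
    _ = ∫ θ in (0 : ℝ)..(π / 2), 1 / (π / 2 + c - θ) := by
        rw [intervalIntegral.integral_comp_sub_left (fun u => 1 / u), add_sub_cancel_left, sub_zero,
          integral_one_div_of_pos hc (by positivity)]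
    _ ≤ ellipticK k :=
        intervalIntegral.integral_mono_on pi_div_two_pos.le hint
          ((continuous_one_div_ellipticDelta hk).intervalIntegrable _ _) fun θ hθ =>
            one_div_le_one_div_of_le (ellipticDelta_pos hk θ)
              (ellipticDelta_le_pi_div_two_add_sub hk.le hθ)

theorem tendsto_ellipticK_nhdsLT_one : Tendsto ellipticK (𝓝[<] 1) atTop := by
  have hmem : Ioo (-1 : ℝ) 1 ∈ 𝓝[<] (1 : ℝ) := Ioo_mem_nhdsLT (by norm_num)
  have hsqrt : Tendsto (fun k : ℝ => √(1 - k ^ 2)) (𝓝[<] 1) (𝓝[≠] 0) := by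
    refine tendsto_nhdsWithin_iff.2 ⟨?_, ?_⟩
    · have : ContinuousAt (fun k : ℝ => √(1 - k ^ 2)) 1 := by fun_prop
      simpa using this.tendsto.mono_left nhdsWithin_le_nhds
    · filter_upwards [hmem] with k hk
      exact (sqrt_pos.2 (by nlinarith [hk.1, hk.2])).ne'
  refine tendsto_atTop_mono' _ ?_
    (tendsto_neg_atBot_atTop.comp (tendsto_log_nhdsNE_zero.comp hsqrt))
  filter_upwards [hmem] with k hk
  exact neg_log_sqrt_one_sub_sq_le_ellipticK (by nlinarith [hk.1, hk.2])

theorem ellipticP_eq_integral (hk : k ^ 2 < 1) :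
    ellipticP k = ∫ θ in (0 : ℝ)..(π / 2),
      (2 * ellipticDelta k θ - 1 / ellipticDelta k θ * (1 - k ^ 2)) := by
  rw [intervalIntegral.integral_sub
    (((continuous_ellipticDelta k).const_mul 2).intervalIntegrable _ _)
    (((continuous_one_div_ellipticDelta hk).mul_const _).intervalIntegrable _ _),
    intervalIntegral.integral_const_mul, intervalIntegral.integral_mul_const]
  rfl

theorem hasDerivAt_sin_mul_cos_div_ellipticDelta_add (hk : k ^ 2 < 1) (hl : l ^ 2 < 1) (θ : ℝ) :
    HasDerivAt
      (fun θ => (l ^ 2 - k ^ 2) * (sin θ * cos θ) / (ellipticDelta k θ + ellipticDelta l θ))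
      ((2 * ellipticDelta l θ - 1 / ellipticDelta l θ * (1 - l ^ 2)) -
        (2 * ellipticDelta k θ - 1 / ellipticDelta k θ * (1 - k ^ 2)) -
        (l ^ 2 - k ^ 2) * (cos θ ^ 2 / (ellipticDelta k θ + ellipticDelta l θ))) θ := by
  have ha0 := ellipticDelta_pos hk θ
  have hb0 := ellipticDelta_pos hl θ
  refine ((((hasDerivAt_sin θ).mul (hasDerivAt_cos θ)).const_mul (l ^ 2 - k ^ 2)).div
    ((hasDerivAt_ellipticDelta hk θ).add (hasDerivAt_ellipticDelta hl θ))
    (add_pos ha0 hb0).ne').congr_deriv ?_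
  have ha := ellipticDelta_sq hk θ
  have hb := ellipticDelta_sq hl θ
  have hintegrand {m d : ℝ} (hd0 : 0 < d) (hd : d ^ 2 = 1 - m ^ 2 * sin θ ^ 2) :
      2 * d - 1 / d * (1 - m ^ 2) = d + m ^ 2 * cos θ ^ 2 / d := by
    field_simp
    linear_combination hd - m ^ 2 * sin_sq_add_cos_sq θ
  simp only [Pi.add_apply, Pi.mul_apply]
  rw [hintegrand ha0 ha, hintegrand hb0 hb]
  generalize ellipticDelta k θ = a, ellipticDelta l θ = b, sin θ = s, cos θ = c at *
  have hdiff : (l ^ 2 - k ^ 2) * s ^ 2 - (a - b) * (a + b) = 0 := by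
    linear_combination hb - ha
  rw [← sub_eq_zero, ← mul_zero (-1 / (a + b) + c ^ 2 * (k ^ 2 / a + l ^ 2 / b) / (a + b) ^ 2),
    ← hdiff]
  field_simp
  ring

theorem ellipticP_sub_ellipticP (hk : k ^ 2 < 1) (hl : l ^ 2 < 1) :
    ellipticP l - ellipticP k = (l ^ 2 - k ^ 2) *
      ∫ θ in (0 : ℝ)..(π / 2), cos θ ^ 2 / (ellipticDelta k θ + ellipticDelta l θ) := by
  have hP {m : ℝ} (hm : m ^ 2 < 1) : IntervalIntegrable
      (fun θ => 2 * ellipticDelta m θ - 1 / ellipticDelta m θ * (1 - m ^ 2))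
      MeasureTheory.volume 0 (π / 2) :=
    (((continuous_ellipticDelta m).const_mul 2).sub
      ((continuous_one_div_ellipticDelta hm).mul_const _)).intervalIntegrable _ _
  have hq : IntervalIntegrable
      (fun θ => (l ^ 2 - k ^ 2) * (cos θ ^ 2 / (ellipticDelta k θ + ellipticDelta l θ)))
      MeasureTheory.volume 0 (π / 2) :=
    (((continuous_cos.pow 2).div ((continuous_ellipticDelta k).add (continuous_ellipticDelta l))
      fun θ => (add_pos (ellipticDelta_pos hk θ) (ellipticDelta_pos hl θ)).ne').const_mul
        _).intervalIntegrable _ _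
  have h := intervalIntegral.integral_eq_sub_of_hasDerivAt
    (fun θ _ => hasDerivAt_sin_mul_cos_div_ellipticDelta_add hk hl θ) (((hP hl).sub (hP hk)).sub hq)
  rw [intervalIntegral.integral_sub ((hP hl).sub (hP hk)) hq,
    intervalIntegral.integral_sub (hP hl) (hP hk), ← ellipticP_eq_integral hl,
    ← ellipticP_eq_integral hk, intervalIntegral.integral_const_mul] at h
  simpa [sub_eq_zero] using h

theorem ellipticP_le_ellipticP (hkl : k ^ 2 ≤ l ^ 2) (hl : l ^ 2 < 1) :
    ellipticP k ≤ ellipticP l := by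
  have hk := hkl.trans_lt hl
  rw [← sub_nonneg, ellipticP_sub_ellipticP hk hl]
  exact mul_nonneg (sub_nonneg.2 hkl) <| intervalIntegral.integral_nonneg pi_div_two_pos.le
    fun θ _ => div_nonneg (sq_nonneg _)
      (add_pos (ellipticDelta_pos hk θ) (ellipticDelta_pos hl θ)).le

theorem pi_div_two_le_ellipticP (hk : k ^ 2 < 1) : π / 2 ≤ ellipticP k :=
  ellipticP_zero.symm.trans_le (ellipticP_le_ellipticP (by simpa using sq_nonneg k) hk)

theorem ellipticP_pos (hk : k ^ 2 < 1) : 0 < ellipticP k :=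
  pi_div_two_pos.trans_le (pi_div_two_le_ellipticP hk)

theorem continuousOn_ellipticK : ContinuousOn ellipticK {k | k ^ 2 < 1} := by
  rw [continuousOn_iff_continuous_domRestrict]
  refine intervalIntegral.continuous_parametric_intervalIntegral_of_continuous'
    (f := fun (k : {k : ℝ | k ^ 2 < 1}) θ => 1 / ellipticDelta k θ) ?_ 0 (π / 2)
  refine continuous_const.div ?_ fun p => (ellipticDelta_pos p.1.2 _).ne'
  simp only [ellipticDelta]
  fun_prop

theorem continuous_ellipticE : Continuous ellipticE := by
  refine intervalIntegral.continuous_parametric_intervalIntegral_of_continuous'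
    (f := fun k θ => ellipticDelta k θ) ?_ 0 (π / 2)
  simp only [ellipticDelta]
  fun_prop

theorem profileParameter_pos (hk : k ^ 2 < 1) : 0 < profileParameter k :=
  mul_pos (mul_pos two_pos (ellipticK_pos hk)) (ellipticP_pos hk)

theorem continuousOn_profileParameter : ContinuousOn profileParameter {k | k ^ 2 < 1} :=
  (continuousOn_ellipticK.const_mul 2).mul <|
    (continuous_ellipticE.continuousOn.const_mul 2).sub (continuousOn_ellipticK.mul (by fun_prop))

theorem profileParameter_zero : profileParameter 0 = π ^ 2 / 2 := by
  rw [profileParameter, ellipticK_zero, ellipticP_zero]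
  ring

theorem profileParameter_lt_profileParameter (hkl : k ^ 2 < l ^ 2) (hl : l ^ 2 < 1) :
    profileParameter k < profileParameter l := by
  have hk := hkl.trans hl
  have hK := ellipticK_lt_ellipticK hkl hl
  exact mul_lt_mul (by linarith) (ellipticP_le_ellipticP hkl.le hl) (ellipticP_pos hk)
    (by linarith [ellipticK_pos hl])

theorem tendsto_profileParameter_nhdsLT_one : Tendsto profileParameter (𝓝[<] 1) atTop := by
  refine tendsto_atTop_mono' _ ?_ tendsto_ellipticK_nhdsLT_one
  filter_upwards [Ioo_mem_nhdsLT (show (-1 : ℝ) < 1 by norm_num)] with k hk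
  have hk2 : k ^ 2 < 1 := by nlinarith [hk.1, hk.2]
  rw [profileParameter]
  nlinarith [ellipticK_pos hk2, pi_div_two_le_ellipticP hk2, pi_gt_three]

theorem sq_lt_one_of_mem_Ico (hk : k ∈ Ico (0 : ℝ) 1) : k ^ 2 < 1 :=
  (sq_lt_one_iff₀ hk.1).2 hk.2

theorem bijOn_profileParameter : BijOn profileParameter (Ioo 0 1) (Ioi (π ^ 2 / 2)) := by
  have hmono : StrictMonoOn profileParameter (Ico 0 1) := fun k hk l hl hkl =>
    profileParameter_lt_profileParameter ((sq_lt_sq₀ hk.1 hl.1).2 hkl) (sq_lt_one_of_mem_Ico hl)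
  have h0 : (0 : ℝ) ∈ Ico (0 : ℝ) 1 := ⟨le_rfl, one_pos⟩
  rw [← profileParameter_zero]
  refine ⟨fun k hk => hmono h0 (Ioo_subset_Ico_self hk) hk.1,
    hmono.injOn.mono Ioo_subset_Ico_self, fun r hr => ?_⟩
  obtain ⟨k, hk, rfl⟩ := isPreconnected_Ico.intermediate_value_Ici h0
    (nhdsWithin_Ico_eq_nhdsLT (zero_lt_one' ℝ) ▸ le_principal_iff.2 self_mem_nhdsWithin)
    (continuousOn_profileParameter.mono fun _ => sq_lt_one_of_mem_Ico)
    tendsto_profileParameter_nhdsLT_one (mem_Ici_of_Ioi hr)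
  have hk0 : k ≠ 0 := by
    rintro rfl
    exact (mem_Ioi.1 hr).false
  exact ⟨k, ⟨hk.1.lt_of_ne' hk0, hk.2⟩, rfl⟩

end EllipticIntegrals

section JacobiFunctions

variable {k : ℝ}

theorem ellipticF_jacobiAm (hk : k ^ 2 < 1) (u : ℝ) : ellipticF k (jacobiAm u k) = u :=
  Function.rightInverse_invFun (surjective_ellipticF hk) u

theorem jacobiAm_ellipticF (hk : k ^ 2 < 1) (φ : ℝ) : jacobiAm (ellipticF k φ) k = φ :=
  Function.leftInverse_invFun (strictMono_ellipticF hk).injective φ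

theorem jacobiAm_zero (hk : k ^ 2 < 1) : jacobiAm 0 k = 0 := by
  simpa only [ellipticF_zero] using jacobiAm_ellipticF hk 0

theorem jacobiAm_ellipticK (hk : k ^ 2 < 1) : jacobiAm (ellipticK k) k = π / 2 :=
  jacobiAm_ellipticF hk (π / 2)

theorem jacobiAm_add_two_mul_ellipticK (hk : k ^ 2 < 1) (u : ℝ) :
    jacobiAm (u + 2 * ellipticK k) k = jacobiAm u k + π := by
  rw [← jacobiAm_ellipticF hk (jacobiAm u k + π), ellipticF_add_pi hk, ellipticF_jacobiAm hk]

theorem strictMono_jacobiAm (hk : k ^ 2 < 1) : StrictMono fun u => jacobiAm u k :=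
  fun u w huw => by
    rwa [← (strictMono_ellipticF hk).lt_iff_lt, ellipticF_jacobiAm hk, ellipticF_jacobiAm hk]

theorem continuous_jacobiAm (hk : k ^ 2 < 1) : Continuous fun u => jacobiAm u k :=
  (strictMono_jacobiAm hk).monotone.continuous_of_surjective
    fun φ => ⟨ellipticF k φ, jacobiAm_ellipticF hk φ⟩

theorem jacobiDn_pos (hk : k ^ 2 < 1) (u : ℝ) : 0 < jacobiDn u k :=
  ellipticDelta_pos hk _

theorem jacobiDn_sq_sub_sq_mul_jacobiCn_sq (hk : k ^ 2 < 1) (u : ℝ) :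
    jacobiDn u k ^ 2 - k ^ 2 * jacobiCn u k ^ 2 = 1 - k ^ 2 := by
  have h : jacobiDn u k ^ 2 = 1 - k ^ 2 * sin (jacobiAm u k) ^ 2 := ellipticDelta_sq hk _
  rw [jacobiCn, h]
  linear_combination -k ^ 2 * sin_sq_add_cos_sq (jacobiAm u k)

theorem hasDerivAt_jacobiAm (hk : k ^ 2 < 1) (u : ℝ) :
    HasDerivAt (fun u => jacobiAm u k) (jacobiDn u k) u := by
  have h := HasDerivAt.of_local_left_inverse (continuous_jacobiAm hk).continuousAt
    (hasDerivAt_ellipticF hk (jacobiAm u k)) (one_div_pos.2 (ellipticDelta_pos hk _)).ne'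
    (Eventually.of_forall (ellipticF_jacobiAm hk))
  exact h.congr_deriv (by rw [one_div, inv_inv]; rfl)

theorem hasDerivAt_jacobiSn (hk : k ^ 2 < 1) (u : ℝ) :
    HasDerivAt (fun u => jacobiSn u k) (jacobiCn u k * jacobiDn u k) u :=
  (hasDerivAt_jacobiAm hk u).sin

theorem hasDerivAt_jacobiCn (hk : k ^ 2 < 1) (u : ℝ) :
    HasDerivAt (fun u => jacobiCn u k) (-jacobiSn u k * jacobiDn u k) u :=
  (hasDerivAt_jacobiAm hk u).cos

theorem hasDerivAt_jacobiDn (hk : k ^ 2 < 1) (u : ℝ) :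
    HasDerivAt (fun u => jacobiDn u k) (-(k ^ 2 * jacobiSn u k * jacobiCn u k)) u :=
  ((hasDerivAt_ellipticDelta hk (jacobiAm u k)).comp u (hasDerivAt_jacobiAm hk u)).congr_deriv
    (div_mul_cancel₀ _ (jacobiDn_pos hk u).ne')

theorem continuous_jacobiCn (hk : k ^ 2 < 1) : Continuous fun u => jacobiCn u k :=
  continuous_cos.comp (continuous_jacobiAm hk)

theorem continuous_jacobiDn (hk : k ^ 2 < 1) : Continuous fun u => jacobiDn u k :=
  (continuous_ellipticDelta k).comp (continuous_jacobiAm hk)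

theorem jacobiSn_add_two_mul_ellipticK (hk : k ^ 2 < 1) (u : ℝ) :
    jacobiSn (u + 2 * ellipticK k) k = -jacobiSn u k := by
  rw [jacobiSn, jacobiSn, jacobiAm_add_two_mul_ellipticK hk, sin_add_pi]

theorem jacobiCn_add_two_mul_ellipticK (hk : k ^ 2 < 1) (u : ℝ) :
    jacobiCn (u + 2 * ellipticK k) k = -jacobiCn u k := by
  rw [jacobiCn, jacobiCn, jacobiAm_add_two_mul_ellipticK hk, cos_add_pi]

theorem jacobiDn_add_two_mul_ellipticK (hk : k ^ 2 < 1) (u : ℝ) :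
    jacobiDn (u + 2 * ellipticK k) k = jacobiDn u k := by
  rw [jacobiDn, jacobiDn, jacobiSn_add_two_mul_ellipticK hk, neg_sq]

theorem abs_mul_jacobiCn_lt_jacobiDn (hk : k ^ 2 < 1) (u : ℝ) :
    |k * jacobiCn u k| < jacobiDn u k :=
  abs_lt_of_sq_lt_sq (by linarith [mul_pow k (jacobiCn u k) 2,
    jacobiDn_sq_sub_sq_mul_jacobiCn_sq hk u]) (jacobiDn_pos hk u).le

theorem jacobiDn_add_mul_jacobiCn_pos (hk : k ^ 2 < 1) (u : ℝ) :
    0 < jacobiDn u k + k * jacobiCn u k := by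
  linarith [(abs_lt.1 (abs_mul_jacobiCn_lt_jacobiDn hk u)).1]

theorem jacobiDn_sub_mul_jacobiCn_pos (hk : k ^ 2 < 1) (u : ℝ) :
    0 < jacobiDn u k - k * jacobiCn u k :=
  sub_pos.2 (abs_lt.1 (abs_mul_jacobiCn_lt_jacobiDn hk u)).2

theorem integral_jacobiDn_sq (hk : k ^ 2 < 1) (u : ℝ) :
    ∫ v in (u - 2 * ellipticK k)..u, jacobiDn v k ^ 2 = 2 * ellipticE k := by
  have ham := jacobiAm_add_two_mul_ellipticK hk (u - 2 * ellipticK k)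
  rw [sub_add_cancel] at ham
  calc ∫ v in (u - 2 * ellipticK k)..u, jacobiDn v k ^ 2
      = ∫ v in (u - 2 * ellipticK k)..u, ellipticDelta k (jacobiAm v k) * jacobiDn v k := by
        simp only [sq]
        rfl
    _ = ∫ θ in jacobiAm (u - 2 * ellipticK k) k..(jacobiAm (u - 2 * ellipticK k) k + π),
          ellipticDelta k θ := by
        rw [← ham]
        exact intervalIntegral.integral_comp_mul_deriv (fun v _ => hasDerivAt_jacobiAm hk v)
          (continuous_jacobiDn hk).continuousOn (continuous_ellipticDelta k)
    _ = 2 * ellipticE k :=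
        intervalIntegral_add_eq_two_mul_of_periodic_of_even (continuous_ellipticDelta k)
          (periodic_ellipticDelta k) (even_ellipticDelta k) _

theorem integral_jacobiDn_add_mul_jacobiCn_sq (hk : k ^ 2 < 1) (u : ℝ) :
    ∫ v in (u - 2 * ellipticK k)..u, (jacobiDn v k + k * jacobiCn v k) ^ 2 =
      2 * ellipticP k + 4 * k * jacobiSn u k := by
  have hdn := continuous_jacobiDn hk
  have hcn := continuous_jacobiCn hk
  have hexpand (v : ℝ) : (jacobiDn v k + k * jacobiCn v k) ^ 2 =
      2 * jacobiDn v k ^ 2 - (1 - k ^ 2) + 2 * k * (jacobiCn v k * jacobiDn v k) := by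
    linear_combination -jacobiDn_sq_sub_sq_mul_jacobiCn_sq hk v
  have hsn : ∫ v in (u - 2 * ellipticK k)..u, jacobiCn v k * jacobiDn v k =
      2 * jacobiSn u k := by
    rw [intervalIntegral.integral_eq_sub_of_hasDerivAt (fun v _ => hasDerivAt_jacobiSn hk v)
      ((hcn.mul hdn).intervalIntegrable _ _)]
    have h := jacobiSn_add_two_mul_ellipticK hk (u - 2 * ellipticK k)
    rw [sub_add_cancel] at h
    linarith
  simp only [hexpand]
  rw [intervalIntegral.integral_add (Continuous.intervalIntegrable (by fun_prop) _ _)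
      (Continuous.intervalIntegrable (by fun_prop) _ _),
    intervalIntegral.integral_sub (Continuous.intervalIntegrable (by fun_prop) _ _)
      (Continuous.intervalIntegrable (by fun_prop) _ _),
    intervalIntegral.integral_const_mul, intervalIntegral.integral_const_mul,
    intervalIntegral.integral_const, integral_jacobiDn_sq hk, hsn, ellipticP, smul_eq_mul]
  ring

end JacobiFunctions

section SinhPendulum

/-- The solution `u ↦ log ((dn + k cn) / (dn - k cn))` of `p'' = -(1 - k²) sinh p` with
`p 0 = 2 artanh k` and `p' 0 = 0`. -/
def sinhPendulum (k u : ℝ) : ℝ :=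
  log ((jacobiDn u k + k * jacobiCn u k) / (jacobiDn u k - k * jacobiCn u k))

variable {k : ℝ}

theorem exp_sinhPendulum (hk : k ^ 2 < 1) (u : ℝ) :
    exp (sinhPendulum k u) = (jacobiDn u k + k * jacobiCn u k) ^ 2 / (1 - k ^ 2) := by
  have hv := jacobiDn_add_mul_jacobiCn_pos hk u
  have hw := jacobiDn_sub_mul_jacobiCn_pos hk u
  rw [sinhPendulum, exp_log (div_pos hv hw), ← jacobiDn_sq_sub_sq_mul_jacobiCn_sq hk u,
    div_eq_div_iff hw.ne' (by nlinarith [jacobiDn_sq_sub_sq_mul_jacobiCn_sq hk u])]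
  ring

theorem antiperiodic_sinhPendulum (hk : k ^ 2 < 1) :
    Function.Antiperiodic (sinhPendulum k) (2 * ellipticK k) := fun u => by
  rw [sinhPendulum, sinhPendulum, jacobiDn_add_two_mul_ellipticK hk,
    jacobiCn_add_two_mul_ellipticK hk, mul_neg, sub_neg_eq_add, ← sub_eq_add_neg, ← log_inv,
    inv_div]

theorem sinh_sinhPendulum (hk : k ^ 2 < 1) (u : ℝ) :
    (1 - k ^ 2) * sinh (sinhPendulum k u) = 2 * k * (jacobiCn u k * jacobiDn u k) := by
  have hk' : 1 - k ^ 2 ≠ 0 := by linarith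
  rw [sinh_eq, ← antiperiodic_sinhPendulum hk u, exp_sinhPendulum hk, exp_sinhPendulum hk,
    jacobiDn_add_two_mul_ellipticK hk, jacobiCn_add_two_mul_ellipticK hk]
  field_simp
  ring

theorem hasDerivAt_sinhPendulum (hk : k ^ 2 < 1) (u : ℝ) :
    HasDerivAt (sinhPendulum k) (-2 * k * jacobiSn u k) u := by
  have hv := jacobiDn_add_mul_jacobiCn_pos hk u
  have hw := jacobiDn_sub_mul_jacobiCn_pos hk u
  have hdn := hasDerivAt_jacobiDn hk u
  have hcn := (hasDerivAt_jacobiCn hk u).const_mul k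
  refine (((hdn.add hcn).div (hdn.sub hcn) hw.ne').log (div_pos hv hw).ne').congr_deriv ?_
  simp only [Pi.add_apply, Pi.sub_apply, Pi.div_apply]
  field_simp
  ring

theorem continuous_sinhPendulum (hk : k ^ 2 < 1) : Continuous (sinhPendulum k) :=
  continuous_iff_continuousAt.2 fun u => (hasDerivAt_sinhPendulum hk u).continuousAt

theorem sinhPendulum_zero (hk : k ^ 2 < 1) : sinhPendulum k 0 = 2 * artanh k := by
  have hmem : k ∈ Icc (-1 : ℝ) 1 := abs_le.1 ((sq_lt_one_iff_abs_lt_one k).1 hk).le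
  simp [sinhPendulum, jacobiDn, jacobiSn, jacobiCn, jacobiAm_zero hk, artanh_eq_half_log hmem]

theorem jacobiCn_eq_of_sinhPendulum_eq (hk : k ^ 2 < 1) (hk0 : k ≠ 0) {u w : ℝ}
    (h : sinhPendulum k u = sinhPendulum k w) : jacobiCn u k = jacobiCn w k := by
  have hk' : 1 - k ^ 2 ≠ 0 := by linarith
  have hadd (u : ℝ) := jacobiDn_add_mul_jacobiCn_pos hk u
  have hprod := (jacobiDn_sq_sub_sq_mul_jacobiCn_sq hk u).trans
    (jacobiDn_sq_sub_sq_mul_jacobiCn_sq hk w).symm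
  have hplus : jacobiDn u k + k * jacobiCn u k = jacobiDn w k + k * jacobiCn w k := by
    rw [← sq_eq_sq₀ (hadd u).le (hadd w).le, ← div_left_inj' hk', ← exp_sinhPendulum hk, h,
      exp_sinhPendulum hk]
  have hminus : jacobiDn u k - k * jacobiCn u k = jacobiDn w k - k * jacobiCn w k := by
    apply mul_left_cancel₀ (hadd u).ne'
    nth_rw 2 [hplus]
    linear_combination hprod
  apply mul_left_cancel₀ hk0
  linarith

theorem isLeast_period_sinhPendulum (hk : k ^ 2 < 1) (hk0 : k ≠ 0) :
    IsLeast {T : ℝ | 0 < T ∧ Function.Periodic (sinhPendulum k) T} (2 * (2 * ellipticK k)) := by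
  refine ⟨⟨by linarith [ellipticK_pos hk], (antiperiodic_sinhPendulum hk).periodic_two_mul⟩,
    fun T ⟨hT, hper⟩ => ?_⟩
  by_contra! hlt
  have ham_pos : 0 < jacobiAm T k := by
    simpa only [jacobiAm_zero hk] using strictMono_jacobiAm hk hT
  have ham_lt : jacobiAm T k < 2 * π := by
    have := strictMono_jacobiAm hk (hlt.trans_eq (two_mul _))
    simp only at this
    rw [jacobiAm_add_two_mul_ellipticK hk] at this
    have hK := jacobiAm_add_two_mul_ellipticK hk 0
    rw [zero_add, jacobiAm_zero hk] at hK
    linarith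
  have hcos : cos (jacobiAm T k) = 1 := by
    simpa only [jacobiCn, jacobiAm_zero hk, cos_zero] using
      jacobiCn_eq_of_sinhPendulum_eq hk hk0 (hper.eq)
  exact ham_pos.ne' ((cos_eq_one_iff_of_lt_of_lt (by linarith [pi_pos]) ham_lt).1 hcos)

end SinhPendulum

section AutonomousODE

theorem hasDerivAt_comp_affine {f : ℝ → ℝ} {f' ω b t : ℝ} (hf : HasDerivAt f f' (ω * t + b)) :
    HasDerivAt (fun t => f (ω * t + b)) (ω * f') t := by
  have h := hf.comp t (((hasDerivAt_id t).const_mul ω).add_const b)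
  exact h.congr_deriv (by ring)

theorem eq_of_hasDerivAt_of_locallyLipschitz {E : Type*} [NormedAddCommGroup E] [NormedSpace ℝ E]
    {v : E → E} (hv : LocallyLipschitz v) {f g : ℝ → E} (hf : ∀ t, HasDerivAt f (v (f t)) t)
    (hg : ∀ t, HasDerivAt g (v (g t)) t) {t₀ : ℝ} (h₀ : f t₀ = g t₀) : f = g := by
  have hfc : Continuous f := continuous_iff_continuousAt.2 fun t => (hf t).continuousAt
  have hgc : Continuous g := continuous_iff_continuousAt.2 fun t => (hg t).continuousAt
  ext t
  obtain ⟨a, ha⟩ := exists_lt (min t₀ t)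
  obtain ⟨b, hb⟩ := exists_gt (max t₀ t)
  obtain ⟨hat₀, hat⟩ := lt_min_iff.1 ha
  obtain ⟨hbt₀, hbt⟩ := max_lt_iff.1 hb
  set s := f '' Icc a b ∪ g '' Icc a b
  obtain ⟨L, hL⟩ := hv.locallyLipschitzOn.exists_lipschitzOnWith_of_compact (s := s)
    ((isCompact_Icc.image hfc).union (isCompact_Icc.image hgc))
  exact ODE_solution_unique_of_mem_Icc (v := fun _ => v) (s := fun _ => s) (fun _ _ => hL)
    ⟨hat₀, hbt₀⟩ hfc.continuousOn (fun t _ => hf t)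
    (fun t ht => .inl (mem_image_of_mem f (Ioo_subset_Icc_self ht)))
    hgc.continuousOn (fun t _ => hg t)
    (fun t ht => .inr (mem_image_of_mem g (Ioo_subset_Icc_self ht))) h₀ ⟨hat.le, hbt.le⟩

theorem eq_sinhPendulum {y p : ℝ → ℝ} {c t₁ : ℝ} (hc : 0 ≤ c) (hy : ∀ t, HasDerivAt y (p t) t)
    (hp : ∀ t, HasDerivAt p (-(c * sinh (y t))) t) (hp₁ : p t₁ = 0) (t : ℝ) :
    y t = sinhPendulum (tanh (y t₁ / 2))
      (√c * cosh (y t₁ / 2) * t + -(√c * cosh (y t₁ / 2) * t₁)) := by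
  set k := tanh (y t₁ / 2)
  set ω := √c * cosh (y t₁ / 2)
  set b := -(ω * t₁)
  have hk : k ^ 2 < 1 := tanh_sq_lt_one _
  have hω : ω ^ 2 * (1 - k ^ 2) = c := by
    have := (cosh_pos (y t₁ / 2)).ne'
    simp only [ω, k, mul_pow, sq_sqrt hc, tanh_eq_sinh_div_cosh, div_pow]
    field_simp
    linear_combination c * cosh_sq_sub_sinh_sq (y t₁ / 2)
  have hz (t : ℝ) : HasDerivAt (fun t => sinhPendulum k (ω * t + b))
      (ω * (-2 * k * jacobiSn (ω * t + b) k)) t :=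
    hasDerivAt_comp_affine (hasDerivAt_sinhPendulum hk _)
  have hq (t : ℝ) : HasDerivAt (fun t => ω * (-2 * k * jacobiSn (ω * t + b) k))
      (-(c * sinh (sinhPendulum k (ω * t + b)))) t := by
    refine (hasDerivAt_comp_affine
      (((hasDerivAt_jacobiSn hk _).const_mul (-2 * k)).const_mul ω)).congr_deriv ?_
    linear_combination ω ^ 2 * sinh_sinhPendulum hk (ω * t + b) -
      sinh (sinhPendulum k (ω * t + b)) * hω
  have hv : LocallyLipschitz fun w : ℝ × ℝ => (w.2, -(c * sinh w.1)) :=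
    ContDiff.locallyLipschitz (𝕂 := ℝ) (by fun_prop)
  have h := eq_of_hasDerivAt_of_locallyLipschitz hv (fun t => (hy t).prodMk (hp t))
    (fun t => (hz t).prodMk (hq t)) (t₀ := t₁) ?_
  · exact congrArg Prod.fst (congrFun h t)
  · simp only [b, add_neg_cancel, hp₁, sinhPendulum_zero hk, jacobiSn, jacobiAm_zero hk, sin_zero,
      mul_zero, k, artanh_tanh, mul_div_cancel₀ (y t₁) (two_ne_zero' ℝ)]

end AutonomousODE

section DelayEquation

theorem hasDerivAt_intervalIntegral_comp_sub {g : ℝ → ℝ} (hg : Continuous g) (a b t : ℝ) :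
    HasDerivAt (fun t => ∫ s in a..b, g (t - s)) (g (t - a) - g (t - b)) t := by
  have hprim (u : ℝ) : HasDerivAt (fun u => ∫ v in (0 : ℝ)..u, g v) (g u) u :=
    (hg.integral_hasStrictDerivAt 0 u).hasDerivAt
  have heq : (fun t => ∫ s in a..b, g (t - s)) =
      fun t => (∫ v in (0 : ℝ)..(t - a), g v) - ∫ v in (0 : ℝ)..(t - b), g v := by
    ext t
    rw [intervalIntegral.integral_comp_sub_left g t, intervalIntegral.integral_interval_sub_left
      (hg.intervalIntegrable _ _) (hg.intervalIntegrable _ _)]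
  rw [heq]
  exact ((hprim (t - a)).comp_sub_const t a).sub ((hprim (t - b)).comp_sub_const t b)

theorem IsDelaySolution.continuous {f x : ℝ → ℝ} (h : IsDelaySolution f x) : Continuous x :=
  continuous_iff_continuousAt.2 fun t => (h t).continuousAt

theorem IsSSPS.exists_isMax {f x : ℝ → ℝ} (hx : IsSSPS f x) {m : ℝ}
    (hm : ∀ t, x t + x (t - 1) = 2 * m) : ∃ t₁, (∀ t, x t ≤ x t₁) ∧ m < x t₁ := by
  obtain ⟨_, ⟨t₁, rfl⟩, hmax⟩ := (hx.minimal_period.1.2.compact_of_continuous two_ne_zero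
    hx.solution.continuous).exists_isGreatest (range_nonempty x)
  have hle (t : ℝ) : x t ≤ x t₁ := hmax ⟨t, rfl⟩
  refine ⟨t₁, hle, ?_⟩
  by_contra! hm₁
  have hconst (t : ℝ) : x t = m := by
    linarith [hm t, (hle t).trans hm₁, (hle (t - 1)).trans hm₁]
  have h21 : (2 : ℝ) ≤ 1 := hx.minimal_period.2 ⟨one_pos, fun t => by rw [hconst, hconst]⟩
  norm_num at h21

variable {k m r : ℝ}

theorem integral_exp_add_sinhPendulum (hk : k ^ 2 < 1) (m b t : ℝ) :
    ∫ s in (0 : ℝ)..1, exp (m + sinhPendulum k (2 * ellipticK k * (t - s) + b)) =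
      exp m * (ellipticP k + 2 * k * jacobiSn (2 * ellipticK k * t + b) k) /
        ((1 - k ^ 2) * ellipticK k) := by
  have hK := (ellipticK_pos hk).ne'
  have hk' : 1 - k ^ 2 ≠ 0 := by linarith
  have harg (s : ℝ) : 2 * ellipticK k * (t - s) + b =
      2 * ellipticK k * t + b - 2 * ellipticK k * s := by ring
  simp only [exp_add, exp_sinhPendulum hk, harg]
  rw [intervalIntegral.integral_const_mul, intervalIntegral.integral_div,
    intervalIntegral.integral_comp_sub_mul
      (fun u => (jacobiDn u k + k * jacobiCn u k) ^ 2) (by positivity),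
    mul_one, mul_zero, sub_zero, integral_jacobiDn_add_mul_jacobiCn_sq hk, smul_eq_mul]
  field_simp
  ring

theorem integral_feedback_const_add_sinhPendulum (hk : k ^ 2 < 1) (r m b t : ℝ) :
    ∫ s in (0 : ℝ)..1, r * (exp (m + sinhPendulum k (2 * ellipticK k * (t - s) + b)) - 1) =
      r * (exp m * (ellipticP k + 2 * k * jacobiSn (2 * ellipticK k * t + b) k) /
        ((1 - k ^ 2) * ellipticK k) - 1) := by
  have hcont := continuous_sinhPendulum hk
  rw [intervalIntegral.integral_const_mul, intervalIntegral.integral_sub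
    (Continuous.intervalIntegrable (by fun_prop) _ _) intervalIntegrable_const,
    integral_exp_add_sinhPendulum hk, intervalIntegral.integral_const, sub_zero, one_smul]

theorem isDelaySolution_const_add_sinhPendulum_iff (hk : k ^ 2 < 1) (hk0 : k ≠ 0) (hr : r ≠ 0)
    (b : ℝ) :
    IsDelaySolution (fun u => r * (exp u - 1))
        (fun t => m + sinhPendulum k (2 * ellipticK k * t + b)) ↔
      exp m = (1 - k ^ 2) * ellipticK k / ellipticP k ∧ r = profileParameter k := by
  have hK := ellipticK_pos hk
  have hP := ellipticP_pos hk
  have hk' : 1 - k ^ 2 ≠ 0 := by linarith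
  have hderiv (t : ℝ) : HasDerivAt (fun t => m + sinhPendulum k (2 * ellipticK k * t + b))
      (2 * ellipticK k * (-2 * k * jacobiSn (2 * ellipticK k * t + b) k)) t :=
    (hasDerivAt_comp_affine (hasDerivAt_sinhPendulum hk _)).const_add m
  constructor
  · intro h
    have heq (u : ℝ) : 2 * ellipticK k * (-2 * k * jacobiSn u k) = -(r * (exp m *
        (ellipticP k + 2 * k * jacobiSn u k) / ((1 - k ^ 2) * ellipticK k) - 1)) := by
      have := (hderiv ((u - b) / (2 * ellipticK k))).unique (h _)
      rwa [integral_feedback_const_add_sinhPendulum hk, mul_div_cancel₀ _ (by positivity),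
        sub_add_cancel] at this
    have h₀ := heq 0
    have hK₁ := heq (ellipticK k)
    simp only [jacobiSn, jacobiAm_zero hk, jacobiAm_ellipticK hk, sin_zero, sin_pi_div_two,
      mul_zero, mul_one, add_zero, zero_eq_neg, mul_eq_zero, hr, false_or] at h₀ hK₁
    have hm : exp m = (1 - k ^ 2) * ellipticK k / ellipticP k := by
      field_simp at h₀ ⊢
      linarith
    refine ⟨hm, ?_⟩
    rw [hm] at hK₁
    field_simp at hK₁
    apply mul_left_cancel₀ hk0
    rw [profileParameter]
    linear_combination hK₁ / 2
  · rintro ⟨hm, rfl⟩ t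
    refine (hderiv t).congr_deriv ?_
    rw [integral_feedback_const_add_sinhPendulum hk, hm, profileParameter]
    field_simp
    ring

theorem logisticProfile_eq (hk : k ^ 2 < 1) (t : ℝ) :
    logisticProfile k t = log ((1 - k ^ 2) * ellipticK k / ellipticP k) +
      sinhPendulum k (2 * ellipticK k * t) := by
  have hk' : 0 < 1 - k ^ 2 := by linarith
  have hK := ellipticK_pos hk
  have hP := ellipticP_pos hk
  rw [← log_exp (sinhPendulum k _), exp_sinhPendulum hk,
    ← log_mul (by positivity)
      (div_pos (pow_pos (jacobiDn_add_mul_jacobiCn_pos hk _) 2) hk').ne', logisticProfile,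
    ← ellipticP]
  congr 1
  field_simp

theorem isSSPS_logisticProfile (hk : k ^ 2 < 1) (hk0 : k ≠ 0) :
    IsSSPS (fun u => profileParameter k * (exp u - 1)) (logisticProfile k) := by
  have hK := ellipticK_pos hk
  have hP := ellipticP_pos hk
  have hA : 0 < (1 - k ^ 2) * ellipticK k / ellipticP k := by
    have : 0 < 1 - k ^ 2 := by linarith
    positivity
  have hx : logisticProfile k = fun t => log ((1 - k ^ 2) * ellipticK k / ellipticP k) +
      sinhPendulum k (2 * ellipticK k * t + 0) := by
    ext t
    rw [logisticProfile_eq hk, add_zero]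
  rw [hx]
  refine ⟨?_, ?_, 2 * log ((1 - k ^ 2) * ellipticK k / ellipticP k), fun t => ?_⟩
  · exact (isDelaySolution_const_add_sinhPendulum_iff hk hk0 (profileParameter_pos hk).ne' 0).2
      ⟨exp_log hA, rfl⟩
  · have h := isLeast_period_const_add_comp_affine (by positivity : 0 < 2 * ellipticK k)
      (log ((1 - k ^ 2) * ellipticK k / ellipticP k)) 0 (isLeast_period_sinhPendulum hk hk0)
    rwa [mul_div_cancel_right₀ _ (by positivity)] at h
  · have h := antiperiodic_sinhPendulum hk (2 * ellipticK k * (t - 1) + 0)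
    rw [show 2 * ellipticK k * (t - 1) + 0 + 2 * ellipticK k = 2 * ellipticK k * t + 0 by ring] at h
    rw [h]
    ring

theorem IsSSPS.exists_eq_const_add_sinhPendulum {x : ℝ → ℝ} (hr : 0 < r)
    (hx : IsSSPS (fun u => r * (exp u - 1)) x) :
    ∃ k ∈ Ioo (0 : ℝ) 1, ∃ m b, x = fun t => m + sinhPendulum k (2 * ellipticK k * t + b) := by
  obtain ⟨c, hc⟩ := hx.symmetric
  obtain ⟨m, rfl⟩ : ∃ m, c = 2 * m := ⟨c / 2, by ring⟩
  obtain ⟨t₁, hmax, hmt₁⟩ := hx.exists_isMax hc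
  have hxc := hx.solution.continuous
  have hsinh (t : ℝ) : HasDerivAt (fun t => -∫ s in (0 : ℝ)..1, r * (exp (x (t - s)) - 1))
      (-(2 * r * exp m * sinh (x t - m))) t := by
    refine (hasDerivAt_intervalIntegral_comp_sub (g := fun u => r * (exp (x u) - 1)) (by fun_prop)
      0 1 t).neg.congr_deriv ?_
    rw [sub_zero, sinh_eq, neg_sub (x t) m, show x (t - 1) = m + (m - x t) by linarith [hc t],
      show exp (x t) = exp m * exp (x t - m) by rw [← exp_add, add_sub_cancel], exp_add]
    ring
  have hcrit : -∫ s in (0 : ℝ)..1, r * (exp (x (t₁ - s)) - 1) = 0 :=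
    IsLocalMax.hasDerivAt_eq_zero (Eventually.of_forall hmax) (hx.solution t₁)
  have heq := eq_sinhPendulum (by positivity) (fun t => (hx.solution t).sub_const m) hsinh hcrit
  set k := tanh ((x t₁ - m) / 2)
  set ω := √(2 * r * exp m) * cosh ((x t₁ - m) / 2)
  have hy : 0 < (x t₁ - m) / 2 := by linarith
  have hk0 : 0 < k := by
    simp only [k, tanh_eq_sinh_div_cosh]
    exact div_pos (sinh_pos_iff.2 hy) (cosh_pos _)
  have hω : 0 < ω := mul_pos (sqrt_pos.2 (by positivity)) (cosh_pos _)
  have hx_eq : x = fun t => m + sinhPendulum k (ω * t + -(ω * t₁)) := by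
    ext t
    rw [← heq, add_sub_cancel]
  have hωK : ω = 2 * ellipticK k := by
    have h := isLeast_period_const_add_comp_affine hω m (-(ω * t₁))
      (isLeast_period_sinhPendulum (tanh_sq_lt_one _) hk0.ne')
    rw [← hx_eq] at h
    have h2 := h.unique hx.minimal_period
    rw [div_eq_iff hω.ne'] at h2
    linarith
  exact ⟨k, ⟨hk0, tanh_lt_one _⟩, m, -(ω * t₁), hωK ▸ hx_eq⟩

theorem IsSSPS.exists_eq_logisticProfile {x : ℝ → ℝ} (hr : 0 < r)
    (hx : IsSSPS (fun u => r * (exp u - 1)) x) :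
    ∃ k ∈ Ioo (0 : ℝ) 1, r = profileParameter k ∧ ∃ t₀, ∀ t, x t = logisticProfile k (t + t₀) := by
  obtain ⟨k, hk, m, b, rfl⟩ := hx.exists_eq_const_add_sinhPendulum hr
  have hk2 := sq_lt_one_of_mem_Ico (Ioo_subset_Ico_self hk)
  have hK := ellipticK_pos hk2
  obtain ⟨hm, hrk⟩ :=
    (isDelaySolution_const_add_sinhPendulum_iff hk2 hk.1.ne' hr.ne' b).1 hx.solution
  refine ⟨k, hk, hrk, b / (2 * ellipticK k), fun t => ?_⟩
  rw [logisticProfile_eq hk2, ← hm, log_exp, mul_add, mul_div_cancel₀ b (by positivity)]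

end DelayEquation

end

theorem theorem5 (r : ℝ) (hr : 0 < r) :
    ((∃ x : ℝ → ℝ, IsSSPS (fun u => r * (Real.exp u - 1)) x) ↔ Real.pi ^ 2 / 2 < r) ∧
    (Real.pi ^ 2 / 2 < r →
      (∃! k : ℝ, k ∈ Set.Ioo (0 : ℝ) 1 ∧
        r = 2 * ellipticK k * (2 * ellipticE k - ellipticK k * (1 - k ^ 2))) ∧
      ∀ k ∈ Set.Ioo (0 : ℝ) 1,
        r = 2 * ellipticK k * (2 * ellipticE k - ellipticK k * (1 - k ^ 2)) →
        IsSSPS (fun u => r * (Real.exp u - 1)) (logisticProfile k) ∧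
        ∀ x : ℝ → ℝ, IsSSPS (fun u => r * (Real.exp u - 1)) x →
          ∃ t₀ : ℝ, ∀ t : ℝ, x t = logisticProfile k (t + t₀)) := by
  have hsq {k : ℝ} (hk : k ∈ Set.Ioo (0 : ℝ) 1) : k ^ 2 < 1 :=
    sq_lt_one_of_mem_Ico (Set.Ioo_subset_Ico_self hk)
  refine ⟨⟨?_, fun hr₂ => ?_⟩, fun hr₂ => ⟨?_, ?_⟩⟩
  · rintro ⟨x, hx⟩
    obtain ⟨k, hk, rfl, -⟩ := hx.exists_eq_logisticProfile hr
    exact bijOn_profileParameter.mapsTo hk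
  · obtain ⟨k, hk, rfl⟩ := bijOn_profileParameter.surjOn hr₂
    exact ⟨_, isSSPS_logisticProfile (hsq hk) hk.1.ne'⟩
  · obtain ⟨k, hk, rfl⟩ := bijOn_profileParameter.surjOn hr₂
    exact ⟨k, ⟨hk, rfl⟩, fun l hl => bijOn_profileParameter.injOn hl.1 hk hl.2.symm⟩
  · rintro k hk rfl
    refine ⟨isSSPS_logisticProfile (hsq hk) hk.1.ne', fun x hx => ?_⟩
    obtain ⟨l, hl, hkl, hx⟩ := hx.exists_eq_logisticProfile hr
    obtain rfl := bijOn_profileParameter.injOn hk hl hkl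
    exact hx
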